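/- A hypermap $\mathfrak{hm}$ is a decomposition of a compact closed surface $M$ (orientable or not) into finitely many closed discs of three types, $0$ = vertices, $1$ = hyperedges, $2$ = faces, such that discs of the same type are disjoint and discs of different types meet only along arcs of their boundaries. Its local flags are the points where discs of all three types meet. For $k\in\{0,1,2\}$ the $k$-lines are the arcs in which discs of the two types different from $k$ meet; they join the flags in pairs, and $\tau_k=\tau_k(\mathfrak{hm})$ is the involution of the set of flags which swaps the two ends of each $k$-line. Let $\{a,b,c\}=\{0,1,2\}$ and let $S$ be a set of cells of type $a$. The partial dual $\mathfrak{hm}^S$ is constructed as follows. (1) Let $\partial F$ be the boundary of the union $F$ of the cells in $S$ and all cells of type $b$. (2) Glue a disc to each component of $\partial F$; these are the $b$-cells of $\mathfrak{hm}^S$. (3) Take a copy of every $a$-cell of $\mathfrak{hm}$ and attach it to the new $b$-cells exactly along the intervals which the old $a$-cell contributes to $\partial F$; these are the $a$-cells of $\mathfrak{hm}^S$. (4) Glue a disc to each boundary component of the resulting surface; these are the $c$-cells of $\mathfrak{hm}^S$. For $k\neq a$ let $\tau_k^{S}$ be the product of all transpositions in $\tau_k$ of flags around cells $v\in S$ (it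 fixes all other flags). **Theorem.** All flags of $\mathfrak{hm}$ lie on $\partial F$, and the gluing of $\partial F$ onto the boundaries of the $b$-cells of $\mathfrak{hm}^S$ identifies the set of flags of $\mathfrak{hm}$ with the set of flags of $\mathfrak{hm}^{S}$. Under this identification $$\tau_a(\mathfrak{hm}^{S})=\tau_a,\qquad \tau_b(\mathfrak{hm}^{S})=\tau_b\,\tau_b^{S}\,\tau_c^{S},\qquad \tau_c(\mathfrak{hm}^{S})=\tau_c\,\tau_c^{S}\,\tau_b^{S},$$ that is, $\tau_b$ and $\tau_c$ swap their transpositions of local flags around the cells in $S$. In particular, for a set $V'$ of vertices ($a=0$): $\tau_0(\mathfrak{hm}^{V'})=\tau_0$, $\tau_1(\mathfrak{hm}^{V'})=\tau_1\tau_1^{V'}\tau_2^{V'}$, $\tau_2(\mathfrak{hm}^{V'})=\tau_2\tau_2^{V'}\tau_1^{V'}$; the cases $a=1$ and $a=2$ are the statements for sets of hyperedges and of faces. -/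

import Mathlib

open Set

/-- A closed disc in a closed surface: a subset homeomorphic to the closed unit disc of the plane,
whose boundary circle is its frontier. (For a closed disc embedded in a surface without boundary
the last clause is automatic, by invariance of domain.) -/
def IsClosedDisc {M : Type*} [TopologicalSpace M] (D : Set M) : Prop :=
  ∃ h : Metric.closedBall (0 : EuclideanSpace ℝ (Fin 2)) 1 ≃ₜ D,
    ∀ x, ((h x : D) : M) ∈ frontier D ↔ ‖(x : EuclideanSpace ℝ (Fin 2))‖ = 1

/-- The union of all cells of type `i`. -/
def cellRegion {M : Type*} (cells : Fin 3 → Set (Set M)) (i : Fin 3) : Set M :=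
  ⋃₀ cells i

/-- The union of the `k`-lines: the points lying in cells of both types different from `k`. -/
def lineSet {M : Type*} (cells : Fin 3 → Set (Set M)) (k : Fin 3) : Set M :=
  {x | ∀ i, i ≠ k → x ∈ cellRegion cells i}

/-- The points where cells of all three types meet. -/
def tripleSet {M : Type*} (cells : Fin 3 → Set (Set M)) : Set M :=
  {x | ∀ i, x ∈ cellRegion cells i}

/-- A hypermap on a closed surface `M` (compact Hausdorff 2-manifold without boundary, orientable or
not, connected or not): a decomposition of `M` into finitely many closed discs of three types,
`0` = vertices, `1` = hyperedges, `2` = faces, such that discs of the same type are disjoint and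
discs of different types meet only along arcs of their boundaries. -/
structure Hypermap (M : Type*) [TopologicalSpace M] [T2Space M] [CompactSpace M]
    [ChartedSpace (EuclideanSpace ℝ (Fin 2)) M] where
  /-- the cells of each type, as subsets of the surface -/
  cells : Fin 3 → Set (Set M)
  finite_cells : ∀ i, (cells i).Finite
  isClosedDisc : ∀ i, ∀ D ∈ cells i, IsClosedDisc D
  pairwiseDisjoint : ∀ i, (cells i).PairwiseDisjoint id
  cover : ⋃ i, cellRegion cells i = univ
  inter_subset : ∀ i j, i ≠ j → ∀ D ∈ cells i, ∀ D' ∈ cells j,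
    D ∩ D' ⊆ frontier D ∩ frontier D'
  /-- The common boundary of the cells of two types is a union of disjoint arcs (its connected
  components), and the points of such an arc that lie on a cell of the third type are exactly its
  two end points. (In a closed surface three discs can only meet at the ends of their common arcs;
  what is excluded is two cells sharing a whole boundary circle.) -/
  arcs : ∀ k, ∀ x ∈ lineSet cells k,
    ∃ h : unitInterval ≃ₜ connectedComponentIn (lineSet cells k) x,
      ∀ t, ((h t : connectedComponentIn (lineSet cells k) x) : M) ∈ tripleSet cells ↔
        t = 0 ∨ t = 1
  finite_triple : (tripleSet cells).Finite

namespace Hypermap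

section

variable {M : Type*} [TopologicalSpace M] [T2Space M] [CompactSpace M]
  [ChartedSpace (EuclideanSpace ℝ (Fin 2)) M]

/-- The local flags of a hypermap: the points where cells of all three types meet. -/
abbrev Flag (H : Hypermap M) : Type _ := tripleSet H.cells

/-- The union of the boundary circles of the cells of type `i`. -/
def boundary (H : Hypermap M) (i : Fin 3) : Set M :=
  ⋃ D ∈ H.cells i, frontier D

/-- The `k`-line through a flag joins it to exactly one other flag. -/
theorem existsUnique_other_end (H : Hypermap M) (k : Fin 3) (x : H.Flag) :
    ∃! y : H.Flag, y ≠ x ∧ (y : M) ∈ connectedComponentIn (lineSet H.cells k) x := by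
  obtain ⟨x, hx⟩ := x
  have hxl : x ∈ lineSet H.cells k := fun i _ => hx i
  obtain ⟨h, hh⟩ := H.arcs k x hxl
  have hxc : x ∈ connectedComponentIn (lineSet H.cells k) x := mem_connectedComponentIn hxl
  have key : ∀ y : M, y ∈ tripleSet H.cells →
      ∀ hy : y ∈ connectedComponentIn (lineSet H.cells k) x,
      h.symm ⟨y, hy⟩ = 0 ∨ h.symm ⟨y, hy⟩ = 1 := by
    intro y hy hyc
    refine (hh _).1 ?_
    simpa using hy
  have inj : ∀ y z : M, ∀ hy : y ∈ connectedComponentIn (lineSet H.cells k) x,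
      ∀ hz : z ∈ connectedComponentIn (lineSet H.cells k) x,
      h.symm ⟨y, hy⟩ = h.symm ⟨z, hz⟩ → y = z := by
    intro y z hy hz e
    exact congrArg Subtype.val (h.symm.injective e)
  have main : ∀ s t : unitInterval, s ≠ t → (s = 0 ∨ s = 1) → (t = 0 ∨ t = 1) →
      h.symm ⟨x, hxc⟩ = s →
      ∃! y : H.Flag, y ≠ ⟨x, hx⟩ ∧ (y : M) ∈ connectedComponentIn (lineSet H.cells k) x := by
    intro s t hst hs ht hxs
    refine ⟨⟨(h t : connectedComponentIn (lineSet H.cells k) x), (hh t).2 ht⟩,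
      ⟨?_, (h t).2⟩, ?_⟩
    · intro e
      apply hst
      have e' : h t = ⟨x, hxc⟩ := Subtype.ext (congrArg (fun z : H.Flag => (z : M)) e)
      rw [← hxs, ← e', h.symm_apply_apply]
    · rintro ⟨y, hy⟩ ⟨hne, hyc⟩
      have h1 : h.symm ⟨y, hyc⟩ ≠ s := by
        intro e
        exact hne (Subtype.ext (inj y x hyc hxc (e.trans hxs.symm)))
      have h2 : h.symm ⟨y, hyc⟩ = t := by
        rcases key y hy hyc with e | e <;> rcases hs with rfl | rfl <;>
          rcases ht with rfl | rfl <;> first | exact e | exact absurd e h1 | exact absurd rfl hst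
      apply Subtype.ext
      have h3 : h t = ⟨y, hyc⟩ := by rw [← h2, h.apply_symm_apply]
      exact (congrArg (fun z : connectedComponentIn (lineSet H.cells k) x => (z : M)) h3).symm
  rcases key x hx hxc with e | e
  · exact main 0 1 zero_ne_one (Or.inl rfl) (Or.inr rfl) e
  · exact main 1 0 one_ne_zero (Or.inr rfl) (Or.inl rfl) e

/-- The other end of the `k`-line through a flag. -/
noncomputable def otherEnd (H : Hypermap M) (k : Fin 3) (x : H.Flag) : H.Flag :=
  (H.existsUnique_other_end k x).choose

theorem otherEnd_spec (H : Hypermap M) (k : Fin 3) (x : H.Flag) :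
    H.otherEnd k x ≠ x ∧
      (H.otherEnd k x : M) ∈ connectedComponentIn (lineSet H.cells k) x :=
  (H.existsUnique_other_end k x).choose_spec.1

theorem otherEnd_involutive (H : Hypermap M) (k : Fin 3) :
    Function.Involutive (H.otherEnd k) := by
  intro x
  obtain ⟨h1, h2⟩ := H.otherEnd_spec k x
  refine (H.existsUnique_other_end k (H.otherEnd k x)).unique (H.otherEnd_spec k _)
    ⟨h1.symm, ?_⟩
  rw [← connectedComponentIn_eq h2]
  exact mem_connectedComponentIn fun i _ => x.2 i

/-- The permutation `τ_k` of the local flags, which swaps the two ends of every `k`-line (`0`-lines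
are the arcs between hyperedges and faces, `1`-lines those between vertices and faces, `2`-lines
those between vertices and hyperedges). -/
noncomputable def tau (H : Hypermap M) (k : Fin 3) : Equiv.Perm H.Flag :=
  (H.otherEnd_involutive k).toPerm

open Classical in
theorem tauOn_involutive (H : Hypermap M) (k : Fin 3) (S : Set (Set M)) :
    Function.Involutive (fun x : H.Flag =>
      if ∃ v ∈ S, (x : M) ∈ v ∧ (H.tau k x : M) ∈ v then H.tau k x else x) := by
  intro x
  have hinv : H.tau k (H.tau k x) = x := H.otherEnd_involutive k x
  by_cases hx : ∃ v ∈ S, (x : M) ∈ v ∧ (H.tau k x : M) ∈ v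
  · have hx' : ∃ v ∈ S, (H.tau k x : M) ∈ v ∧ (H.tau k (H.tau k x) : M) ∈ v := by
      obtain ⟨v, hv, h1, h2⟩ := hx
      exact ⟨v, hv, h2, by rw [hinv]; exact h1⟩
    simp only [if_pos hx]
    rw [if_pos hx', hinv]
  · simp only [if_neg hx]

open Classical in
/-- The permutation `τ_k^S`, product of all transpositions `(x, τ_k x)` of `τ_k` whose flags are
around a cell `v ∈ S`. -/
noncomputable def tauOn (H : Hypermap M) (k : Fin 3) (S : Set (Set M)) : Equiv.Perm H.Flag :=
  (H.tauOn_involutive k S).toPerm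

/-- The boundary `∂F` of the surface `F` which is the union of the cells in `S` and of all cells of
type `b`. -/
def unionBoundary (H : Hypermap M) (b : Fin 3) (S : Set (Set M)) : Set M :=
  frontier (⋃₀ S ∪ cellRegion H.cells b)

end

/-- The construction of the partial dual of `H` relative to a set `S` of cells of type `a`, with
chosen second type `b ≠ a` (say `a` = vertices, `b` = hyperedges): what it means that the hypermap
`H'` is the outcome of the construction.

* Step 1: take the boundary `∂F` of the union `F` of the cells in `S` and all cells of type `b`.
* Step 2: a disc is glued to each component of `∂F`, and these discs are the `b`-cells of `H'`: the
  embedding `φ` identifies `∂F` with the union of the (disjoint) boundary circles of the `b`-cells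
  of `H'`.
* Step 3: the `a`-cells of `H'` are copies, under `ψ`, of those of `H`; they are attached to
  the `b`-cells exactly along the same intervals of `∂F` as the old ones.
* Step 4: a disc is glued to each boundary component of the union of these cells; these discs are
  the cells of the third type of `H'`, and complete a closed surface `M'`. This is expressed by `H'`
  being a hypermap on `M'`. -/
structure PartialDual {M M' : Type*}
    [TopologicalSpace M] [T2Space M] [CompactSpace M]
    [ChartedSpace (EuclideanSpace ℝ (Fin 2)) M]
    [TopologicalSpace M'] [T2Space M'] [CompactSpace M']
    [ChartedSpace (EuclideanSpace ℝ (Fin 2)) M']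
    (H : Hypermap M) (a b : Fin 3) (S : Set (Set M)) (H' : Hypermap M') where
  /-- the gluing map of the new `b`-cells along `∂F` -/
  φ : H.unionBoundary b S → M'
  isEmbedding_φ : Topology.IsEmbedding φ
  range_φ : range φ = H'.boundary b
  /-- the identification of the old `a`-cells with their copies in the new surface -/
  ψ : cellRegion H.cells a → M'
  isEmbedding_ψ : Topology.IsEmbedding ψ
  range_ψ : range ψ = cellRegion H'.cells a
  /-- the copies are copies of discs with their boundary circles -/
  ψ_mem_boundary : ∀ x, ψ x ∈ H'.boundary a ↔ (x : M) ∈ H.boundary a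
  /-- the new `a`-cells are attached along the same intervals of `∂F` as the old ones, -/
  ψ_eq_φ : ∀ (x : M) (hx : x ∈ cellRegion H.cells a) (hx' : x ∈ H.unionBoundary b S),
    ψ ⟨x, hx⟩ = φ ⟨x, hx'⟩
  /-- and nowhere else -/
  attached : cellRegion H'.cells a ∩ cellRegion H'.cells b =
    ψ '' {x | (x : M) ∈ H.unionBoundary b S}

end Hypermap

/-!
For `{a, b, c} = {0, 1, 2}` write `R i` for the union of the `i`-cells of `H` and split `R a` into
the part `U` covered by `S` and the part `U'` covered by the remaining `a`-cells; these are disjoint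
closed sets. The frontier of a union of cells is its intersection with the union of the other cells
(`frontier_sUnion`), because the boundary circle of a disc lies in the closure of its interior. So
`∂F = (U ∪ R b) ∩ (U' ∪ R c)`, which contains all flags, and the boundary circles of the `i`-cells
are covered by the two kinds of lines on them.

Hence the lines of the dual `H'` are known (`lineSet_c`, `lineSet_a`, `lineSet_b`):
the `c`-lines of `H'` are the copies of `A = (U ∩ R c) ∪ (U' ∩ R b)`, the points of the `a`-cells on
`∂F`; the `a`-lines of `H'` fill the rest of `∂F`, so they are the copies of the `a`-lines of `H`; the
`b`-lines of `H'` fill the rest of the boundaries of the `a`-cells, so they are the copies of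
`(U ∩ R b) ∪ (U' ∩ R c)`. Since `U` and `U'` are separated, the components of these sets around `S`
and away from `S` are `b`- or `c`-lines of `H`, with `b` and `c` exchanged around `S` only.

That the flags of `H'` are the copies of those of `H` follows from the `c`-lines alone: a flag is an
end of an arc, that is, a point whose removal leaves the arc connected
(`mem_tripleSet_iff_isPreconnected`), and this is invariant under embeddings.
-/

/-! ### Connected components and embeddings -/

theorem connectedComponentIn_union_left {X : Type*} [TopologicalSpace X] {P Q : Set X}
    (hP : IsClosed P) (hQ : IsClosed Q) (hPQ : Disjoint P Q) {x : X} (hx : x ∈ P) :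
    connectedComponentIn (P ∪ Q) x = connectedComponentIn P x := by
  apply Subset.antisymm
  · have hxc : x ∈ connectedComponentIn (P ∪ Q) x := mem_connectedComponentIn (Or.inl hx)
    refine isPreconnected_connectedComponentIn.subset_connectedComponentIn hxc ?_
    intro y hy
    by_contra hyP
    have hyQ : y ∈ Q := (connectedComponentIn_subset _ _ hy).resolve_left hyP
    obtain ⟨z, -, hz, hz'⟩ := isPreconnected_closed_iff.1 isPreconnected_connectedComponentIn
      P Q hP hQ (connectedComponentIn_subset _ _) ⟨x, hxc, hx⟩ ⟨y, hy, hyQ⟩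
    exact hPQ.le_bot ⟨hz, hz'⟩
  · exact connectedComponentIn_mono x subset_union_left

theorem Topology.IsEmbedding.connectedComponentIn_image {X Y : Type*} [TopologicalSpace X]
    [TopologicalSpace Y] {e : X → Y} (he : Topology.IsEmbedding e) {s : Set X} {x : X}
    (hx : x ∈ s) : connectedComponentIn (e '' s) (e x) = e '' connectedComponentIn s x := by
  apply Subset.antisymm
  · have hsub : connectedComponentIn (e '' s) (e x) ⊆ e '' s := connectedComponentIn_subset _ _
    have himg : e '' (e ⁻¹' connectedComponentIn (e '' s) (e x))
        = connectedComponentIn (e '' s) (e x) :=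
      image_preimage_eq_of_subset (hsub.trans (image_subset_range _ _))
    rw [← himg]
    apply image_mono
    refine IsPreconnected.subset_connectedComponentIn ?_ ?_ ?_
    · rw [← he.isInducing.isPreconnected_image, himg]
      exact isPreconnected_connectedComponentIn
    · exact mem_connectedComponentIn (mem_image_of_mem e hx)
    · intro y hy
      obtain ⟨z, hz, e'⟩ := hsub hy
      exact he.injective e' ▸ hz
  · exact (isPreconnected_connectedComponentIn.image e
      he.continuous.continuousOn).subset_connectedComponentIn
      (mem_image_of_mem e (mem_connectedComponentIn hx))
      (image_mono (connectedComponentIn_subset _ _))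

theorem Topology.IsEmbedding.connectedComponentIn_image_preimage_val {X Y : Type*}
    [TopologicalSpace X] [TopologicalSpace Y] {s t : Set X} {f : s → Y}
    (hf : Topology.IsEmbedding f) (hts : t ⊆ s) {x : X} (hx : x ∈ t) :
    connectedComponentIn (f '' (Subtype.val ⁻¹' t)) (f ⟨x, hts hx⟩)
      = f '' (Subtype.val ⁻¹' connectedComponentIn t x) := by
  rw [hf.connectedComponentIn_image (show (⟨x, hts hx⟩ : s) ∈ Subtype.val ⁻¹' t from hx)]
  have h := Topology.IsEmbedding.subtypeVal.connectedComponentIn_image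
    (show (⟨x, hts hx⟩ : s) ∈ Subtype.val ⁻¹' t from hx)
  rw [image_preimage_eq_of_subset (by rwa [Subtype.range_coe])] at h
  change connectedComponentIn t x = _ at h
  rw [h, preimage_image_eq _ Subtype.val_injective]

theorem unitInterval.isPreconnected_compl_singleton_iff (t : unitInterval) :
    IsPreconnected ({t}ᶜ : Set unitInterval) ↔ t = 0 ∨ t = 1 := by
  constructor
  · intro h
    by_contra! hne
    exact h.ordConnected.out (x := 0) (y := 1) (fun e => hne.1 e.symm) (fun e => hne.2 e.symm)
      ⟨t.2.1, t.2.2⟩ rfl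
  · rintro (rfl | rfl)
    · have : ({0}ᶜ : Set unitInterval) = Ioi 0 := by
        ext y; exact unitInterval.pos_iff_ne_zero.symm
      rw [this]; exact isPreconnected_Ioi
    · have : ({1}ᶜ : Set unitInterval) = Iio 1 := by
        ext y; exact unitInterval.lt_one_iff_ne_one.symm
      rw [this]; exact isPreconnected_Iio

/-! ### Closed discs -/

theorem IsClosedDisc.isCompact {M : Type*} [TopologicalSpace M] {D : Set M} (hD : IsClosedDisc D) :
    IsCompact D := by
  obtain ⟨h, -⟩ := hD
  have := h.compactSpace
  exact isCompact_iff_compactSpace.2 this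

theorem IsClosedDisc.exists_mem_diff_frontier {M : Type*} [TopologicalSpace M] {D : Set M}
    (hD : IsClosedDisc D) {x : M} (hx : x ∈ D) {V : Set M} (hV : V ∈ nhds x) :
    ∃ y ∈ V, y ∈ D ∧ y ∉ frontier D := by
  obtain ⟨h, hh⟩ := hD
  set p := h.symm ⟨x, hx⟩ with hp
  have hpx : ((h p : D) : M) = x := by simp [hp]
  -- The points `r • p` with `r < 1` are interior and tend to `p` as `r → 1`.
  have hmem : ∀ r : unitInterval, (r : ℝ) • (p : EuclideanSpace ℝ (Fin 2)) ∈
      Metric.closedBall (0 : EuclideanSpace ℝ (Fin 2)) 1 := by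
    intro r
    have h1 : ‖(p : EuclideanSpace ℝ (Fin 2))‖ ≤ 1 := mem_closedBall_zero_iff.1 p.2
    rw [mem_closedBall_zero_iff, norm_smul, Real.norm_of_nonneg r.2.1]
    exact mul_le_one₀ r.2.2 (norm_nonneg _) h1
  let g : unitInterval → M := fun r => (h ⟨(r : ℝ) • (p : EuclideanSpace ℝ (Fin 2)), hmem r⟩ : D)
  have hg : Continuous g := by
    refine continuous_subtype_val.comp (h.continuous.comp ?_)
    exact Continuous.subtype_mk (continuous_subtype_val.smul continuous_const) _
  have hg1 : g 1 = x := by simp [g, hpx]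
  have hev : g ⁻¹' V ∈ nhds (1 : unitInterval) :=
    hg.continuousAt.preimage_mem_nhds (by rwa [hg1])
  have hdense : (1 : unitInterval) ∈ closure (Iio 1) := by
    rw [closure_Iio' ⟨0, zero_lt_one⟩]; exact self_mem_Iic
  obtain ⟨r, hrV, hr⟩ := mem_closure_iff_nhds.1 hdense _ hev
  refine ⟨g r, hrV, (h _).2, fun hfr => ?_⟩
  have h1 : ‖(p : EuclideanSpace ℝ (Fin 2))‖ ≤ 1 := mem_closedBall_zero_iff.1 p.2
  have h2 := (hh _).1 hfr
  rw [norm_smul, Real.norm_of_nonneg r.2.1] at h2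
  have h3 : (r : ℝ) < 1 := hr
  nlinarith [r.2.1, norm_nonneg (p : EuclideanSpace ℝ (Fin 2))]

namespace Hypermap

variable {M : Type*} [TopologicalSpace M] [T2Space M] [CompactSpace M]
  [ChartedSpace (EuclideanSpace ℝ (Fin 2)) M] (H : Hypermap M)

/-! ### Cells and their frontiers -/

theorem isClosed_sUnion {i : Fin 3} {S : Set (Set M)} (hS : S ⊆ H.cells i) :
    IsClosed (⋃₀ S) :=
  (((H.finite_cells i).subset hS).isCompact_sUnion
    fun D hD => (H.isClosedDisc i D (hS hD)).isCompact).isClosed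

theorem disjoint_sUnion {i : Fin 3} {S : Set (Set M)} (hS : S ⊆ H.cells i) :
    Disjoint (⋃₀ S) (⋃₀ (H.cells i \ S)) := by
  rw [disjoint_sUnion_left]
  intro D hD
  rw [disjoint_sUnion_right]
  intro D' hD'
  exact H.pairwiseDisjoint i (hS hD) hD'.1 fun e => hD'.2 (e ▸ hD)

theorem sUnion_union_sUnion_diff {i : Fin 3} {S : Set (Set M)} (hS : S ⊆ H.cells i) :
    ⋃₀ S ∪ ⋃₀ (H.cells i \ S) = cellRegion H.cells i := by
  rw [← sUnion_union, union_sdiff_cancel hS, cellRegion]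

theorem disjoint_cells {i j : Fin 3} (hij : i ≠ j) : Disjoint (H.cells i) (H.cells j) := by
  rw [Set.disjoint_left]
  intro D hi hj
  -- A disc of two types would coincide with its frontier.
  have hD := H.isClosedDisc i D hi
  have hne : D.Nonempty := by
    obtain ⟨h, -⟩ := hD
    exact ⟨_, (h ⟨0, by simp⟩).2⟩
  obtain ⟨x, hx⟩ := hne
  obtain ⟨y, -, hy, hyf⟩ := hD.exists_mem_diff_frontier hx Filter.univ_mem
  exact hyf (H.inter_subset i j hij D hi D hj ⟨hy, hy⟩).1

theorem inter_subset_frontier {D D' : Set M} {i j : Fin 3} (hD : D ∈ H.cells i)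
    (hD' : D' ∈ H.cells j) (hne : D ≠ D') : D ∩ D' ⊆ frontier D' := by
  rcases eq_or_ne i j with rfl | hij
  · intro x hx
    exact ((H.pairwiseDisjoint i hD hD' hne).le_bot hx).elim
  · exact fun x hx => (H.inter_subset i j hij D hD D' hD' hx).2

/-- The boundary of a union of cells consists of its points on the other cells. -/
theorem frontier_sUnion {T : Set (Set M)} (hT : T ⊆ ⋃ i, H.cells i) :
    frontier (⋃₀ T) = ⋃₀ T ∩ ⋃₀ ((⋃ i, H.cells i) \ T) := by
  have hfin : (⋃ i, H.cells i).Finite := finite_iUnion H.finite_cells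
  have hcl : ∀ T' ⊆ ⋃ i, H.cells i, IsClosed (⋃₀ T') := fun T' hT' =>
    ((hfin.subset hT').isCompact_sUnion fun D hD => by
      obtain ⟨i, hi⟩ := mem_iUnion.1 (hT' hD)
      exact (H.isClosedDisc i D hi).isCompact).isClosed
  have hcover : (⋃₀ T)ᶜ ⊆ ⋃₀ ((⋃ i, H.cells i) \ T) := by
    intro x hx
    have hx' : x ∈ ⋃ i, cellRegion H.cells i := by rw [H.cover]; trivial
    obtain ⟨i, D, hD, hxD⟩ := mem_iUnion.1 hx'
    exact ⟨D, ⟨mem_iUnion.2 ⟨i, hD⟩, fun h => hx ⟨D, h, hxD⟩⟩, hxD⟩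
  rw [frontier_eq_closure_inter_closure, (hcl T hT).closure_eq]
  apply Subset.antisymm
  · exact inter_subset_inter_right _ (closure_minimal hcover (hcl _ sdiff_subset))
  · rintro x ⟨hxT, D', ⟨hD', hD'T⟩, hxD'⟩
    refine ⟨hxT, mem_closure_iff_nhds.2 fun V hV => ?_⟩
    obtain ⟨j, hj⟩ := mem_iUnion.1 hD'
    obtain ⟨y, hyV, hyD', hyf⟩ := (H.isClosedDisc j D' hj).exists_mem_diff_frontier hxD' hV
    refine ⟨y, hyV, ?_⟩
    rintro ⟨D, hD, hyD⟩
    obtain ⟨i, hi⟩ := mem_iUnion.1 (hT hD)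
    exact hyf (H.inter_subset_frontier hi hj (fun e => hD'T (e ▸ hD)) ⟨hyD, hyD'⟩)

section Types

variable {a b c : Fin 3} (hab : a ≠ b) (hac : a ≠ c) (hbc : b ≠ c)

include hab hac hbc

theorem _root_.Fin.forall_three_iff_of_ne {p : Fin 3 → Prop} :
    (∀ i, p i) ↔ p a ∧ p b ∧ p c := by
  have key : ∀ i, i = a ∨ i = b ∨ i = c := by omega
  refine ⟨fun h => ⟨h a, h b, h c⟩, fun h i => ?_⟩
  rcases key i with rfl | rfl | rfl
  exacts [h.1, h.2.1, h.2.2]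

theorem _root_.Fin.exists_three_iff_of_ne {p : Fin 3 → Prop} :
    (∃ i, p i) ↔ p a ∨ p b ∨ p c := by
  have := Fin.forall_three_iff_of_ne hab hac hbc (p := fun i => ¬ p i)
  rw [← not_exists] at this
  tauto

theorem lineSet_eq_inter : lineSet H.cells c = cellRegion H.cells a ∩ cellRegion H.cells b := by
  ext x
  simp only [lineSet, mem_ofPred_eq, mem_inter_iff]
  rw [Fin.forall_three_iff_of_ne hab hac hbc]
  simp [hac, hbc]

theorem mem_tripleSet_iff {x : M} : x ∈ tripleSet H.cells ↔
    x ∈ cellRegion H.cells a ∧ x ∈ cellRegion H.cells b ∧ x ∈ cellRegion H.cells c :=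
  Fin.forall_three_iff_of_ne hab hac hbc

theorem boundary_eq_inter : H.boundary a =
    cellRegion H.cells a ∩ (cellRegion H.cells b ∪ cellRegion H.cells c) := by
  have hfr : ∀ D ∈ H.cells a, frontier D = D ∩ ⋃₀ ((⋃ i, H.cells i) \ {D}) := by
    intro D hD
    have := H.frontier_sUnion (T := {D}) (singleton_subset_iff.2 (mem_iUnion.2 ⟨a, hD⟩))
    rwa [sUnion_singleton] at this
  ext x
  simp only [boundary, mem_iUnion, mem_inter_iff, exists_prop]
  constructor
  · rintro ⟨D, hD, hx⟩
    rw [hfr D hD] at hx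
    obtain ⟨hxD, D', ⟨hD', hne⟩, hxD'⟩ := hx
    refine ⟨⟨D, hD, hxD⟩, ?_⟩
    rw [mem_iUnion, Fin.exists_three_iff_of_ne hab hac hbc] at hD'
    rcases hD' with h | h | h
    · exact ((H.pairwiseDisjoint a hD h (Ne.symm hne)).le_bot ⟨hxD, hxD'⟩).elim
    · exact Or.inl ⟨D', h, hxD'⟩
    · exact Or.inr ⟨D', h, hxD'⟩
  · rintro ⟨⟨D, hD, hxD⟩, ⟨D', hD', hxD'⟩ | ⟨D', hD', hxD'⟩⟩
    · exact ⟨D, hD, (H.inter_subset a b hab D hD D' hD' ⟨hxD, hxD'⟩).1⟩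
    · exact ⟨D, hD, (H.inter_subset a c hac D hD D' hD' ⟨hxD, hxD'⟩).1⟩

theorem unionBoundary_eq_inter {S : Set (Set M)} (hS : S ⊆ H.cells a) : H.unionBoundary b S =
    (⋃₀ S ∪ cellRegion H.cells b) ∩ (⋃₀ (H.cells a \ S) ∪ cellRegion H.cells c) := by
  have hcells : (⋃ i, H.cells i) \ (S ∪ H.cells b) = (H.cells a \ S) ∪ H.cells c := by
    ext D
    have h1 := fun h : D ∈ H.cells a => Set.disjoint_left.1 (H.disjoint_cells hab) h
    have h2 := fun h : D ∈ H.cells a => Set.disjoint_left.1 (H.disjoint_cells hac) h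
    have h3 := fun h : D ∈ H.cells b => Set.disjoint_left.1 (H.disjoint_cells hbc) h
    have h4 := @hS D
    simp only [mem_sdiff, mem_iUnion, mem_union]
    rw [Fin.exists_three_iff_of_ne hab hac hbc]
    tauto
  have h := H.frontier_sUnion (T := S ∪ H.cells b)
    (union_subset (hS.trans (subset_iUnion _ a)) (subset_iUnion _ b))
  rwa [hcells, sUnion_union, sUnion_union] at h

end Types

/-! ### Lines and flags -/

theorem tripleSet_subset_lineSet (k : Fin 3) : tripleSet H.cells ⊆ lineSet H.cells k :=
  fun _ hx i _ => hx i

/-- A flag is a point of a line whose removal leaves the line connected. -/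
theorem mem_tripleSet_iff_isPreconnected {k : Fin 3} {x : M} (hx : x ∈ lineSet H.cells k) :
    x ∈ tripleSet H.cells ↔
      IsPreconnected (connectedComponentIn (lineSet H.cells k) x \ {x}) := by
  obtain ⟨h, hh⟩ := H.arcs k x hx
  generalize hC : connectedComponentIn (lineSet H.cells k) x = C at h hh ⊢
  have hxC : x ∈ C := hC ▸ mem_connectedComponentIn hx
  obtain ⟨t, ht⟩ := h.surjective ⟨x, hxC⟩
  have hemb : Topology.IsEmbedding (fun s : unitInterval => (h s : M)) :=
    Topology.IsEmbedding.subtypeVal.comp h.isEmbedding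
  have himg : (fun s : unitInterval => (h s : M)) '' {t}ᶜ = C \ {x} := by
    rw [compl_eq_univ_sdiff, image_sdiff hemb.injective, image_singleton, ht, image_univ]
    congr 1
    exact (h.surjective.range_comp (Subtype.val : C → M)).trans Subtype.range_coe
  rw [← himg, hemb.isInducing.isPreconnected_image,
    unitInterval.isPreconnected_compl_singleton_iff, ← hh t, ht]

theorem tau_eq_of_mem {k : Fin 3} {x y : H.Flag} (hne : y ≠ x)
    (hy : (y : M) ∈ connectedComponentIn (lineSet H.cells k) x) : H.tau k x = y :=
  (H.existsUnique_other_end k x).unique (H.otherEnd_spec k x) ⟨hne, hy⟩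

theorem tau_ne (k : Fin 3) (x : H.Flag) : H.tau k x ≠ x := (H.otherEnd_spec k x).1

theorem tau_mem (k : Fin 3) (x : H.Flag) :
    (H.tau k x : M) ∈ connectedComponentIn (lineSet H.cells k) x := (H.otherEnd_spec k x).2

theorem tau_tau (k : Fin 3) (x : H.Flag) : H.tau k (H.tau k x) = x := H.otherEnd_involutive k x

section Around

variable {a k l : Fin 3} (hal : a ≠ l) (hak : a ≠ k) (hlk : l ≠ k) {S : Set (Set M)}
  (hS : S ⊆ H.cells a)

include hal hak hlk hS

/-- If a set agrees on the cells of `S` with the `k`-lines, and is otherwise contained in the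
remaining cells of the same type, then its components around `S` are `k`-lines. -/
theorem connectedComponentIn_of_mem {Q : Set M} (hQ : IsClosed Q) (hQS : Q ⊆ ⋃₀ (H.cells a \ S))
    {x : M} (hx : x ∈ ⋃₀ S ∩ cellRegion H.cells l) :
    connectedComponentIn (⋃₀ S ∩ cellRegion H.cells l ∪ Q) x
      = connectedComponentIn (lineSet H.cells k) x := by
  have hl : IsClosed (cellRegion H.cells l) := H.isClosed_sUnion (subset_refl _)
  have hP := (H.isClosed_sUnion hS).inter hl
  have hdis := H.disjoint_sUnion hS
  rw [connectedComponentIn_union_left hP hQ (hdis.mono inter_subset_left hQS) hx,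
    H.lineSet_eq_inter hal hak hlk, ← H.sUnion_union_sUnion_diff hS, union_inter_distrib_right,
    connectedComponentIn_union_left hP ((H.isClosed_sUnion sdiff_subset).inter hl)
      (hdis.mono inter_subset_left inter_subset_left) hx]

theorem connectedComponentIn_subset_of_mem {x : M}
    (hx : x ∈ ⋃₀ S ∩ cellRegion H.cells l) :
    connectedComponentIn (lineSet H.cells k) x ⊆ ⋃₀ S := by
  rw [← H.connectedComponentIn_of_mem hal hak hlk hS isClosed_empty (empty_subset _) hx,
    union_empty]
  exact (connectedComponentIn_subset _ _).trans inter_subset_left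

theorem tau_mem_sUnion_iff (x : H.Flag) :
    (H.tau k x : M) ∈ ⋃₀ S ↔ (x : M) ∈ ⋃₀ S := by
  have key : ∀ y : H.Flag, (y : M) ∈ ⋃₀ S → (H.tau k y : M) ∈ ⋃₀ S := fun y hy =>
    H.connectedComponentIn_subset_of_mem hal hak hlk hS ⟨hy, y.2 l⟩ (H.tau_mem k y)
  refine ⟨fun h => ?_, key x⟩
  simpa only [tau_tau] using key _ h

theorem tauOn_of_mem {x : H.Flag} (hx : (x : M) ∈ ⋃₀ S) : H.tauOn k S x = H.tau k x := by
  obtain ⟨v, hv, hxv⟩ := hx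
  refine if_pos ⟨v, hv, hxv, ?_⟩
  simpa using (H.tau_mem_sUnion_iff hal hak hlk (singleton_subset_iff.2 (hS hv)) x).2
    (by simpa using hxv)

omit hal hak hlk hS in
theorem tauOn_of_notMem {x : H.Flag} (hx : (x : M) ∉ ⋃₀ S) : H.tauOn k S x = x :=
  if_neg fun ⟨v, hv, hxv, _⟩ => hx ⟨v, hv, hxv⟩

end Around

section Swap

variable {a b c : Fin 3} (hab : a ≠ b) (hac : a ≠ c) (hbc : b ≠ c) {S : Set (Set M)}
  (hS : S ⊆ H.cells a) (x : H.Flag)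

include hab hac hbc hS

/-- Around `S` the permutation `τ_b τ_b^S τ_c^S` acts as `τ_c`: the involution `τ_c` stays on the same
cell, where `τ_b^S` cancels `τ_b`. -/
theorem tau_mul_tauOn_mul_tauOn_of_mem (hx : (x : M) ∈ ⋃₀ S) :
    (H.tau b * H.tauOn b S * H.tauOn c S) x = H.tau c x := by
  have h := (H.tau_mem_sUnion_iff hab hac hbc hS x).2 hx
  rw [Equiv.Perm.mul_apply, Equiv.Perm.mul_apply, H.tauOn_of_mem hab hac hbc hS hx,
    H.tauOn_of_mem hac hab hbc.symm hS h, tau_tau]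

omit hab hac hbc hS in
theorem tau_mul_tauOn_mul_tauOn_of_notMem (hx : (x : M) ∉ ⋃₀ S) :
    (H.tau b * H.tauOn b S * H.tauOn c S) x = H.tau b x := by
  rw [Equiv.Perm.mul_apply, Equiv.Perm.mul_apply, H.tauOn_of_notMem hx, H.tauOn_of_notMem hx]

end Swap

/-! ### Transport of lines along embeddings -/

section Transport

variable {H} {M' : Type*} [TopologicalSpace M'] [T2Space M'] [CompactSpace M']
  [ChartedSpace (EuclideanSpace ℝ (Fin 2)) M'] {H' : Hypermap M'} {s : Set M} {f : s → M'}
  {k k' : Fin 3} {t : Set M}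

theorem connectedComponentIn_lineSet_of_image (hf : Topology.IsEmbedding f) (hts : t ⊆ s)
    (himg : lineSet H'.cells k' = f '' (Subtype.val ⁻¹' t)) {x : M} (hx : x ∈ t)
    (hcomp : connectedComponentIn t x = connectedComponentIn (lineSet H.cells k) x) :
    connectedComponentIn (lineSet H'.cells k') (f ⟨x, hts hx⟩)
      = f '' (Subtype.val ⁻¹' connectedComponentIn (lineSet H.cells k) x) := by
  rw [himg, hf.connectedComponentIn_image_preimage_val hts hx, hcomp]

theorem mem_tripleSet_iff_of_image (hf : Topology.IsEmbedding f) (hts : t ⊆ s)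
    (himg : lineSet H'.cells k' = f '' (Subtype.val ⁻¹' t)) {x : M} (hx : x ∈ t)
    (hxk : x ∈ lineSet H.cells k)
    (hcomp : connectedComponentIn t x = connectedComponentIn (lineSet H.cells k) x) :
    f ⟨x, hts hx⟩ ∈ tripleSet H'.cells ↔ x ∈ tripleSet H.cells := by
  have hx' : f ⟨x, hts hx⟩ ∈ lineSet H'.cells k' := himg ▸ mem_image_of_mem f hx
  rw [H'.mem_tripleSet_iff_isPreconnected hx', H.mem_tripleSet_iff_isPreconnected hxk,
    connectedComponentIn_lineSet_of_image hf hts himg hx hcomp, ← image_singleton,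
    ← image_sdiff hf.injective, hf.isInducing.isPreconnected_image,
    ← Topology.IsInducing.subtypeVal.isPreconnected_image, image_sdiff Subtype.val_injective,
    image_singleton, image_preimage_eq_of_subset]
  rw [Subtype.range_coe, ← hcomp]
  exact (connectedComponentIn_subset _ _).trans hts

theorem tau_eq_of_image (hf : Topology.IsEmbedding f) (hts : t ⊆ s)
    (himg : lineSet H'.cells k' = f '' (Subtype.val ⁻¹' t)) {σ : H.Flag ≃ H'.Flag}
    (hσ : ∀ (y : H.Flag) (hy : (y : M) ∈ s), (σ y : M') = f ⟨y, hy⟩)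
    {x : H.Flag} (hx : (x : M) ∈ t)
    (hcomp : connectedComponentIn t (x : M) = connectedComponentIn (lineSet H.cells k) x) :
    H'.tau k' (σ x) = σ (H.tau k x) := by
  apply H'.tau_eq_of_mem
  · exact σ.injective.ne (H.tau_ne k x)
  · have hmem := H.tau_mem k x
    have hs : (H.tau k x : M) ∈ s := by
      rw [← hcomp] at hmem
      exact hts (connectedComponentIn_subset _ _ hmem)
    rw [hσ _ (hts hx), hσ _ hs, connectedComponentIn_lineSet_of_image hf hts himg hx hcomp]
    exact mem_image_of_mem f hmem

end Transport

/-! ### The lines and flags of the partial dual -/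

namespace PartialDual

/-- The points which lie both on a cell of `S` and on an `l`-cell, or both on another `a`-cell and
on an `m`-cell. -/
def swapSet {M : Type*} [TopologicalSpace M] [T2Space M] [CompactSpace M]
    [ChartedSpace (EuclideanSpace ℝ (Fin 2)) M] (H : Hypermap M) (a : Fin 3) (S : Set (Set M))
    (l m : Fin 3) : Set M :=
  ⋃₀ S ∩ cellRegion H.cells l ∪ ⋃₀ (H.cells a \ S) ∩ cellRegion H.cells m

section SwapSet

variable {H} {a l m : Fin 3} {S : Set (Set M)} (hS : S ⊆ H.cells a)

include hS

theorem swapSet_subset_cellRegion : swapSet H a S l m ⊆ cellRegion H.cells a := by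
  rw [← H.sUnion_union_sUnion_diff hS]
  exact union_subset_union inter_subset_left inter_subset_left

theorem notMem_sUnion_iff {x : M} (hx : x ∈ cellRegion H.cells a) :
    x ∉ ⋃₀ S ↔ x ∈ ⋃₀ (H.cells a \ S) := by
  have h := H.sUnion_union_sUnion_diff hS
  rw [← h] at hx
  exact ⟨hx.resolve_left, fun h1 h2 => (H.disjoint_sUnion hS).le_bot ⟨h2, h1⟩⟩

theorem connectedComponentIn_swapSet_of_mem (hal : a ≠ l) (ham : a ≠ m) (hlm : l ≠ m) {x : M}
    (hx : x ∈ swapSet H a S l m) (hxS : x ∈ ⋃₀ S) :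
    x ∈ lineSet H.cells m ∧
      connectedComponentIn (swapSet H a S l m) x = connectedComponentIn (lineSet H.cells m) x := by
  have hx' : x ∈ ⋃₀ S ∩ cellRegion H.cells l :=
    hx.resolve_right fun h => (H.disjoint_sUnion hS).le_bot ⟨hxS, h.1⟩
  refine ⟨?_, H.connectedComponentIn_of_mem hal ham hlm hS
    ((H.isClosed_sUnion sdiff_subset).inter (H.isClosed_sUnion (subset_refl _)))
    inter_subset_left hx'⟩
  rw [H.lineSet_eq_inter hal ham hlm]
  exact ⟨sUnion_mono hS hx'.1, hx'.2⟩

theorem connectedComponentIn_swapSet_of_notMem (hal : a ≠ l) (ham : a ≠ m) (hlm : l ≠ m) {x : M}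
    (hx : x ∈ swapSet H a S l m) (hxS : x ∉ ⋃₀ S) :
    x ∈ lineSet H.cells l ∧
      connectedComponentIn (swapSet H a S l m) x = connectedComponentIn (lineSet H.cells l) x := by
  -- The roles of `S` and its complement among the `a`-cells are symmetric.
  have hswap : swapSet H a S l m = swapSet H a (H.cells a \ S) m l := by
    rw [swapSet, swapSet, sdiff_sdiff_cancel_left hS, union_comm]
  have hxS' := (notMem_sUnion_iff hS (swapSet_subset_cellRegion hS hx)).1 hxS
  rw [hswap] at hx ⊢
  exact connectedComponentIn_swapSet_of_mem sdiff_subset ham hal hlm.symm hx hxS'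

end SwapSet

variable {H} {M' : Type*} [TopologicalSpace M'] [T2Space M'] [CompactSpace M']
  [ChartedSpace (EuclideanSpace ℝ (Fin 2)) M'] {H' : Hypermap M'}
  {a b c : Fin 3} {S : Set (Set M)} (P : PartialDual H a b S H')

theorem lineSet_subset_unionBoundary (hab : a ≠ b) (hac : a ≠ c) (hbc : b ≠ c)
    (hS : S ⊆ H.cells a) : lineSet H.cells a ⊆ H.unionBoundary b S := by
  rw [H.lineSet_eq_inter hbc hab.symm hac.symm, H.unionBoundary_eq_inter hab hac hbc hS]
  exact fun x hx => ⟨Or.inr hx.1, Or.inr hx.2⟩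

theorem cellRegion_inter_unionBoundary (hab : a ≠ b) (hac : a ≠ c) (hbc : b ≠ c)
    (hS : S ⊆ H.cells a) :
    cellRegion H.cells a ∩ H.unionBoundary b S = swapSet H a S c b := by
  ext x
  have h1 : x ∈ cellRegion H.cells a ↔ x ∈ ⋃₀ S ∨ x ∈ ⋃₀ (H.cells a \ S) := by
    rw [← H.sUnion_union_sUnion_diff hS]; rfl
  have h2 : x ∈ ⋃₀ S → x ∉ ⋃₀ (H.cells a \ S) :=
    fun h h' => (H.disjoint_sUnion hS).le_bot ⟨h, h'⟩
  rw [H.unionBoundary_eq_inter hab hac hbc hS]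
  simp only [swapSet, mem_inter_iff, mem_union, h1]
  tauto

variable (hab : a ≠ b) (hac : a ≠ c) (hbc : b ≠ c) (hS : S ⊆ H.cells a)

include hab hac hbc hS

theorem swapSet_subset_unionBoundary : swapSet H a S c b ⊆ H.unionBoundary b S := by
  rw [← cellRegion_inter_unionBoundary hab hac hbc hS]
  exact inter_subset_right

theorem tripleSet_subset_swapSet : tripleSet H.cells ⊆ swapSet H a S c b := by
  rw [← cellRegion_inter_unionBoundary hab hac hbc hS]
  exact fun x hx => ⟨hx a, lineSet_subset_unionBoundary hab hac hbc hS
    (H.tripleSet_subset_lineSet a hx)⟩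

theorem lineSet_c : lineSet H'.cells c = P.φ '' (Subtype.val ⁻¹' swapSet H a S c b) := by
  rw [H'.lineSet_eq_inter hab hac hbc, P.attached,
    ← cellRegion_inter_unionBoundary hab hac hbc hS]
  ext y
  constructor
  · rintro ⟨⟨x, hx⟩, hx', rfl⟩
    exact ⟨⟨x, hx'⟩, ⟨hx, hx'⟩, (P.ψ_eq_φ x hx hx').symm⟩
  · rintro ⟨⟨x, hx'⟩, ⟨hx, _⟩, rfl⟩
    exact ⟨⟨x, hx⟩, hx', P.ψ_eq_φ x hx hx'⟩

/-- The flags of the dual on the boundary circles of the `b`-cells are recognized as the ends of its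
`c`-lines. -/
theorem φ_mem_tripleSet_iff {x : M} (hx : x ∈ swapSet H a S c b) (hx' : x ∈ H.unionBoundary b S) :
    P.φ ⟨x, hx'⟩ ∈ tripleSet H'.cells ↔ x ∈ tripleSet H.cells := by
  have hsub := swapSet_subset_unionBoundary hab hac hbc hS
  have himg := P.lineSet_c hab hac hbc hS
  by_cases hxS : x ∈ ⋃₀ S
  · obtain ⟨h1, h2⟩ := connectedComponentIn_swapSet_of_mem hS hac hab hbc.symm hx hxS
    exact mem_tripleSet_iff_of_image P.isEmbedding_φ hsub himg hx h1 h2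
  · obtain ⟨h1, h2⟩ := connectedComponentIn_swapSet_of_notMem hS hac hab hbc.symm hx hxS
    exact mem_tripleSet_iff_of_image P.isEmbedding_φ hsub himg hx h1 h2

/-- The `a`-lines of the dual fill the part of `∂F` not covered by its `c`-lines, up to the flags. -/
theorem lineSet_a : lineSet H'.cells a = P.φ '' (Subtype.val ⁻¹' lineSet H.cells a) := by
  have hA := cellRegion_inter_unionBoundary hab hac hbc hS
  have hc := P.lineSet_c hab hac hbc hS
  have hbd := H'.boundary_eq_inter hab.symm hbc hac
  have hla := H'.lineSet_eq_inter hbc hab.symm hac.symm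
  have hlc := H'.lineSet_eq_inter hab hac hbc
  -- A point of `∂F` lies on an `a`-cell if and only if its image under `φ` does.
  have key : ∀ x : H.unionBoundary b S, P.φ x ∈ cellRegion H'.cells b ∧
      (P.φ x ∈ cellRegion H'.cells a ∨ P.φ x ∈ cellRegion H'.cells c) ∧
      (P.φ x ∈ cellRegion H'.cells a ↔ (x : M) ∈ cellRegion H.cells a) := by
    intro x
    have h1 : P.φ x ∈ H'.boundary b := P.range_φ ▸ mem_range_self x
    rw [hbd] at h1
    refine ⟨h1.1, h1.2, fun h => ?_, fun h => ?_⟩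
    · have h2 : P.φ x ∈ lineSet H'.cells c := hlc ▸ ⟨h, h1.1⟩
      rw [hc, ← hA] at h2
      obtain ⟨y, hy, e⟩ := h2
      exact P.isEmbedding_φ.injective e ▸ hy.1
    · have h2 : P.φ x ∈ lineSet H'.cells c := hc ▸ mem_image_of_mem _ (hA ▸ ⟨h, x.2⟩)
      rw [hlc] at h2
      exact h2.1
  have flag : ∀ x : H.unionBoundary b S, (x : M) ∈ cellRegion H.cells a →
      (P.φ x ∈ tripleSet H'.cells ↔ (x : M) ∈ tripleSet H.cells) := fun x hx =>
    P.φ_mem_tripleSet_iff hab hac hbc hS (hA ▸ ⟨hx, x.2⟩) x.2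
  have iff : ∀ x : H.unionBoundary b S,
      P.φ x ∈ lineSet H'.cells a ↔ (x : M) ∈ lineSet H.cells a := by
    intro x
    obtain ⟨h1, h2, h3⟩ := key x
    have h4 := flag x
    rw [H.mem_tripleSet_iff hab hac hbc, H'.mem_tripleSet_iff hab hac hbc] at h4
    have h5 : (x : M) ∈ (⋃₀ S ∪ cellRegion H.cells b) ∩
        (⋃₀ (H.cells a \ S) ∪ cellRegion H.cells c) :=
      H.unionBoundary_eq_inter hab hac hbc hS ▸ x.2
    have h6 : (x : M) ∈ ⋃₀ S → (x : M) ∈ cellRegion H.cells a := fun h => sUnion_mono hS h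
    have h7 : (x : M) ∈ ⋃₀ (H.cells a \ S) → (x : M) ∈ cellRegion H.cells a :=
      fun h => sUnion_mono sdiff_subset h
    simp only [mem_inter_iff, mem_union] at h5
    rw [hla, H.lineSet_eq_inter hbc hab.symm hac.symm]
    simp only [mem_inter_iff]
    tauto
  ext y
  constructor
  · intro hy
    have hyb : y ∈ H'.boundary b := by
      rw [hla] at hy
      rw [hbd]
      exact ⟨hy.1, Or.inr hy.2⟩
    rw [← P.range_φ] at hyb
    obtain ⟨x, rfl⟩ := hyb
    exact mem_image_of_mem _ ((iff x).1 hy)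
  · rintro ⟨x, hx, rfl⟩
    exact (iff x).2 hx

/-- The `b`-lines of the dual fill the part of the boundaries of its `a`-cells not covered by its
`c`-lines, up to the flags. -/
theorem lineSet_b : lineSet H'.cells b = P.ψ '' (Subtype.val ⁻¹' swapSet H a S b c) := by
  have hA := cellRegion_inter_unionBoundary hab hac hbc hS
  have hbd := H.boundary_eq_inter hab hac hbc
  have hbd' := H'.boundary_eq_inter hab hac hbc
  have hlb := H'.lineSet_eq_inter hac hab hbc.symm
  -- A point of an `a`-cell lies on `∂F` if and only if its copy lies on a `b`-cell of the dual.
  have key : ∀ x : cellRegion H.cells a,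
      P.ψ x ∈ cellRegion H'.cells a ∧
      (P.ψ x ∈ cellRegion H'.cells b ↔ (x : M) ∈ swapSet H a S c b) := by
    intro x
    have h1 : P.ψ x ∈ cellRegion H'.cells a := P.range_ψ ▸ mem_range_self x
    refine ⟨h1, fun h => ?_, fun h => ?_⟩
    · have h2 : P.ψ x ∈ cellRegion H'.cells a ∩ cellRegion H'.cells b := ⟨h1, h⟩
      rw [P.attached] at h2
      obtain ⟨y, hy, e⟩ := h2
      rw [← hA]
      exact ⟨x.2, P.isEmbedding_ψ.injective e ▸ hy⟩
    · rw [← hA] at h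
      exact (P.attached ▸ mem_image_of_mem P.ψ h.2 :
        P.ψ x ∈ cellRegion H'.cells a ∩ cellRegion H'.cells b).2
  have iff : ∀ x : cellRegion H.cells a,
      P.ψ x ∈ lineSet H'.cells b ↔ (x : M) ∈ swapSet H a S b c := by
    intro x
    obtain ⟨h1, h2⟩ := key x
    have h3 := P.ψ_mem_boundary x
    have h4 : (x : M) ∈ swapSet H a S c b →
        (P.ψ x ∈ tripleSet H'.cells ↔ (x : M) ∈ tripleSet H.cells) := fun h => by
      have hx' := swapSet_subset_unionBoundary hab hac hbc hS h
      rw [← P.φ_mem_tripleSet_iff hab hac hbc hS h hx', ← P.ψ_eq_φ x x.2 hx']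
    have h5 : (x : M) ∈ cellRegion H.cells a := x.2
    have h6 := notMem_sUnion_iff hS h5
    rw [H.mem_tripleSet_iff hab hac hbc, H'.mem_tripleSet_iff hab hac hbc] at h4
    rw [hbd, hbd'] at h3
    rw [hlb]
    simp only [swapSet, mem_inter_iff, mem_union] at h2 h3 h4 ⊢
    grind
  ext y
  constructor
  · intro hy
    have hya : y ∈ cellRegion H'.cells a := by
      rw [hlb] at hy
      exact hy.1
    rw [← P.range_ψ] at hya
    obtain ⟨x, rfl⟩ := hya
    exact mem_image_of_mem _ ((iff x).1 hy)
  · rintro ⟨x, hx, rfl⟩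
    exact (iff x).2 hx

/-- The gluing map `φ` restricts to a bijection between the flags of the hypermap and those of the
dual. -/
theorem exists_flagEquiv : ∃ σ : H.Flag ≃ H'.Flag,
    ∀ (x : H.Flag) (hx : (x : M) ∈ H.unionBoundary b S), (σ x : M') = P.φ ⟨x, hx⟩ := by
  have hT := tripleSet_subset_swapSet hab hac hbc hS
  have hsub := swapSet_subset_unionBoundary hab hac hbc hS
  let f : H.Flag → H'.Flag := fun x => ⟨P.φ ⟨x, hsub (hT x.2)⟩,
    (P.φ_mem_tripleSet_iff hab hac hbc hS (hT x.2) _).2 x.2⟩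
  have hf : Function.Bijective f := by
    constructor
    · intro x y e
      have e' := P.isEmbedding_φ.injective (congrArg Subtype.val e)
      exact Subtype.ext (congrArg (fun z : H.unionBoundary b S => (z : M)) e')
    · rintro ⟨y, hy⟩
      have hyc := H'.tripleSet_subset_lineSet c hy
      rw [P.lineSet_c hab hac hbc hS] at hyc
      obtain ⟨x, hx, rfl⟩ := hyc
      exact ⟨⟨x, (P.φ_mem_tripleSet_iff hab hac hbc hS hx x.2).1 hy⟩, rfl⟩
  exact ⟨Equiv.ofBijective f hf, fun x hx => rfl⟩

end PartialDual

end Hypermap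

theorem mainTheorem2 {M M' : Type*}
    [TopologicalSpace M] [T2Space M] [CompactSpace M]
    [ChartedSpace (EuclideanSpace ℝ (Fin 2)) M]
    [TopologicalSpace M'] [T2Space M'] [CompactSpace M']
    [ChartedSpace (EuclideanSpace ℝ (Fin 2)) M']
    (H : Hypermap M) (a b c : Fin 3) (hab : a ≠ b) (hac : a ≠ c) (hbc : b ≠ c)
    (S : Set (Set M)) (hS : S ⊆ H.cells a)
    (H' : Hypermap M') (P : Hypermap.PartialDual H a b S H') :
    ∃ σ : H.Flag ≃ H'.Flag,
      (∀ x : H.Flag, ∃ hx : (x : M) ∈ H.unionBoundary b S, (σ x : M') = P.φ ⟨x, hx⟩) ∧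
      H'.tau a = σ.permCongr (H.tau a) ∧
      H'.tau b = σ.permCongr (H.tau b * H.tauOn b S * H.tauOn c S) ∧
      H'.tau c = σ.permCongr (H.tau c * H.tauOn c S * H.tauOn b S) := by
  obtain ⟨σ, hσ⟩ := P.exists_flagEquiv hab hac hbc hS
  have hT := Hypermap.PartialDual.tripleSet_subset_swapSet hab hac hbc hS
  have hsub := Hypermap.PartialDual.swapSet_subset_unionBoundary hab hac hbc hS
  -- On flags, `ψ` agrees with `φ`.
  have hσψ : ∀ (x : H.Flag) (hx : (x : M) ∈ cellRegion H.cells a), (σ x : M') = P.ψ ⟨x, hx⟩ :=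
    fun x hx => by rw [hσ x (hsub (hT x.2)), P.ψ_eq_φ]
  have hperm : ∀ (π : Equiv.Perm H.Flag) (π' : Equiv.Perm H'.Flag),
      (∀ x, π' (σ x) = σ (π x)) → π' = σ.permCongr π := fun π π' h => by
    ext1 y
    obtain ⟨x, rfl⟩ := σ.surjective y
    rw [h, Equiv.permCongr_apply, Equiv.symm_apply_apply]
  refine ⟨σ, fun x => ⟨hsub (hT x.2), hσ x _⟩, hperm _ _ fun x => ?_, hperm _ _ fun x => ?_,
    hperm _ _ fun x => ?_⟩
  · exact Hypermap.tau_eq_of_image P.isEmbedding_φ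
      (Hypermap.PartialDual.lineSet_subset_unionBoundary hab hac hbc hS)
      (P.lineSet_a hab hac hbc hS) hσ (H.tripleSet_subset_lineSet a x.2) rfl
  · have hsub' := Hypermap.PartialDual.swapSet_subset_cellRegion (l := b) (m := c) hS
    have hx := Hypermap.PartialDual.tripleSet_subset_swapSet hac hab hbc.symm hS x.2
    have himg := P.lineSet_b hab hac hbc hS
    by_cases hxS : (x : M) ∈ ⋃₀ S
    · rw [H.tau_mul_tauOn_mul_tauOn_of_mem hab hac hbc hS x hxS]
      exact Hypermap.tau_eq_of_image P.isEmbedding_ψ hsub' himg hσψ hx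
        (Hypermap.PartialDual.connectedComponentIn_swapSet_of_mem hS hab hac hbc hx hxS).2
    · rw [H.tau_mul_tauOn_mul_tauOn_of_notMem x hxS]
      exact Hypermap.tau_eq_of_image P.isEmbedding_ψ hsub' himg hσψ hx
        (Hypermap.PartialDual.connectedComponentIn_swapSet_of_notMem hS hab hac hbc hx hxS).2
  · have hx := hT x.2
    have himg := P.lineSet_c hab hac hbc hS
    by_cases hxS : (x : M) ∈ ⋃₀ S
    · rw [H.tau_mul_tauOn_mul_tauOn_of_mem hac hab hbc.symm hS x hxS]
      exact Hypermap.tau_eq_of_image P.isEmbedding_φ hsub himg hσ hx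
        (Hypermap.PartialDual.connectedComponentIn_swapSet_of_mem hS hac hab hbc.symm hx hxS).2
    · rw [H.tau_mul_tauOn_mul_tauOn_of_notMem x hxS]
      exact Hypermap.tau_eq_of_image P.isEmbedding_φ hsub himg hσ hx
        (Hypermap.PartialDual.connectedComponentIn_swapSet_of_notMem hS hac hab hbc.symm hx hxS).2
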